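/- Let $\kappa<\mu$ be regular cardinals. A small category $J$ is $\kappa$-filtered if every functor to $J$ from a category with fewer than $\kappa$ morphisms admits a cocone. For a category $I$, let $\mathrm{Ind}_\kappa(I)$ be the category whose objects are functors $i_\bullet\colon J\to I$ from small $\kappa$-filtered categories $J$, with morphisms $$\mathrm{Hom}\bigl((J,i_\bullet),(J',i'_\bullet)\bigr)=\lim_{j\in J^{\mathrm{op}}}\operatorname{colim}_{j'\in J'}\mathrm{Hom}(i_j,i'_{j'}).$$ For a small category $C$, the category $\mathrm{Ind}_\kappa(C)$ has all small $\kappa$-filtered colimits; let $\mathrm{Ind}_\kappa^\mu(C)\subset \mathrm{Ind}_\kappa(C)$ be the full subcategory of $\mu$-compact objects, that is, of the objects $X$ such that $\mathrm{Hom}(X,-)$ preserves $\mu$-filtered colimits. The canonical embedding $$\mathrm{Ind}_\mu\bigl(\mathrm{Ind}_\kappa^\mu(C)\bigr)\to \mathrm{Ind}_\kappa(C),\qquad (J,X_\bullet)\mapsto \operatorname{colim}_{j\in J}X_j,$$ the colimit being taken in $\mathrm{Ind}_\kappa(C)$, is the functor that extends the inclusion $\mathrm{Ind}_\kappa^\mu(C)\subset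 \mathrm{Ind}_\kappa(C)$. **Proposition.** The canonical embedding $\mathrm{Ind}_\mu(\mathrm{Ind}_\kappa^\mu(C))\to \mathrm{Ind}_\kappa(C)$ is an equivalence of categories for every small category $C$ if and only if $\kappa\triangleleft\mu$, that is, if and only if for every set $S$ with $|S|<\mu$, the set $P_\kappa(S)$ of subsets of $S$ of cardinality less than $\kappa$, ordered by inclusion, has a cofinal subset of cardinality less than $\mu$. -/

import Mathlib

open CategoryTheory CategoryTheory.Limits Opposite

universe w v u

/-- For cardinals `κ`, `μ`: every set `S` with `|S| < μ` has the property that the poset of subsets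
of `S` of cardinality `< κ`, ordered by inclusion, has a cofinal subset of cardinality `< μ`. -/
def SharplySmaller (κ μ : Cardinal.{w}) : Prop :=
  ∀ S : Type w, Cardinal.mk S < μ →
    ∃ U : Set {T : Set S // Cardinal.mk T < κ}, IsCofinal U ∧ Cardinal.mk U < μ

/-- An `Ind_κ`-object of a category `I`: a functor to `I` from a small `κ`-filtered category. -/
structure IndCard (κ : Cardinal.{w}) [Fact κ.IsRegular] (I : Type u) [Category.{w} I] where
  /-- the small indexing category -/
  J : Type w
  [cat : SmallCategory J]
  [filtered : IsCardinalFiltered J κ]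
  /-- the diagram -/
  diag : J ⥤ I

namespace IndCard

attribute [instance] IndCard.cat IndCard.filtered

section Cat

variable {κ : Cardinal.{w}} [Fact κ.IsRegular] {I : Type u} [Category.{w} I]

/-- The functor `c ↦ colim_j Hom(c, i_j)` attached to the `Ind_κ`-object `i : J ⥤ I`. -/
noncomputable def homColim (X : IndCard κ I) : Iᵒᵖ ⥤ Type w :=
  coyoneda ⋙ (Functor.whiskeringLeft X.J I (Type w)).obj X.diag ⋙ colim

/-- The class in `colim_j Hom(c, i_j)` of a morphism `h : c ⟶ i_j`. -/
noncomputable def cls (X : IndCard κ I) {c : I} (j : X.J) (h : c ⟶ X.diag.obj j) :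
    X.homColim.obj (op c) :=
  colimit.ι (X.diag ⋙ coyoneda.obj (op c)) j h

lemma exists_cls (X : IndCard κ I) {c : I} (x : X.homColim.obj (op c)) :
    ∃ (j : X.J) (h : c ⟶ X.diag.obj j), X.cls j h = x :=
  Types.jointly_surjective' (F := X.diag ⋙ coyoneda.obj (op c)) x

lemma cls_comp (X : IndCard κ I) {c : I} {j j' : X.J} (h : c ⟶ X.diag.obj j) (a : j ⟶ j') :
    X.cls j' (h ≫ X.diag.map a) = X.cls j h :=
  colimit.w_apply (X.diag ⋙ coyoneda.obj (op c)) a h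

lemma map_cls (X : IndCard κ I) {c c' : I} (f : c' ⟶ c) (j : X.J) (h : c ⟶ X.diag.obj j) :
    X.homColim.map f.op (X.cls j h) = X.cls j (f ≫ h) :=
  colimit.ι_map_apply (F := X.diag ⋙ coyoneda.obj (op c))
    (G := X.diag ⋙ coyoneda.obj (op c')) (Functor.whiskerLeft X.diag (coyoneda.map f.op)) j h

/-- A morphism of `Ind_κ`-objects: an element of `lim_j colim_j' Hom(i_j, i'_j')`, the limit of sets
being the set of compatible families. -/
@[ext]
structure Hom (X Y : IndCard κ I) where
  /-- the compatible family -/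
  fam : (X.diag.op ⋙ Y.homColim).sections

lemma Hom.map_fam {X Y : IndCard κ I} (g : Hom X Y) {j j' : X.J} (a : j ⟶ j') :
    Y.homColim.map (X.diag.map a).op (g.fam.1 (op j')) = g.fam.1 (op j) :=
  g.fam.2 a.op

lemma Hom.ext_fam {X Y : IndCard κ I} {f g : Hom X Y}
    (h : ∀ j, f.fam.1 (op j) = g.fam.1 (op j)) : f = g :=
  Hom.ext (Subtype.ext (funext fun j => h j.unop))

/-- The map `colim_j Hom(c, i_j) → P(c)` given by a compatible family of elements
`x_j ∈ P(i_j)`: the class of `h : c ⟶ i_j` goes to the restriction of `x_j` along `h`. -/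
noncomputable def descFamApp (X : IndCard κ I) (P : Iᵒᵖ ⥤ Type w)
    (x : (X.diag.op ⋙ P).sections) (c : Iᵒᵖ) : X.homColim.obj c ⟶ P.obj c :=
  colimit.desc (X.diag ⋙ coyoneda.obj c)
    { pt := P.obj c
      ι :=
        { app := fun j => TypeCat.ofHom fun h : c.unop ⟶ X.diag.obj j => P.map h.op (x.1 (op j))
          naturality := fun j j' a => by
            ext h
            have hx : P.map (X.diag.map a).op (x.1 (op j')) = x.1 (op j) := x.2 a.op
            change P.map (h ≫ X.diag.map a).op (x.1 (op j')) = P.map h.op (x.1 (op j))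
            rw [op_comp, Functor.map_comp_apply, hx] } }

lemma descFamApp_cls (X : IndCard κ I) (P : Iᵒᵖ ⥤ Type w)
    (x : (X.diag.op ⋙ P).sections) {c : I} (j : X.J) (h : c ⟶ X.diag.obj j) :
    X.descFamApp P x (op c) (X.cls j h) = P.map h.op (x.1 (op j)) :=
  colimit.ι_desc_apply (F := X.diag ⋙ coyoneda.obj (op c)) _ j h

/-- The maps `descFamApp` are natural in `c`. -/
noncomputable def descFam (X : IndCard κ I) (P : Iᵒᵖ ⥤ Type w)
    (x : (X.diag.op ⋙ P).sections) : X.homColim ⟶ P where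
  app := X.descFamApp P x
  naturality := fun c c' f => by
    ext y
    obtain ⟨j, h, rfl⟩ := X.exists_cls (c := c.unop) y
    change X.descFamApp P x (op c'.unop) (X.homColim.map f.unop.op (X.cls j h)) =
      P.map f (X.descFamApp P x (op c.unop) (X.cls j h))
    rw [map_cls, descFamApp_cls, descFamApp_cls, op_comp, Functor.map_comp_apply]
    rfl

lemma descFam_cls (X : IndCard κ I) (P : Iᵒᵖ ⥤ Type w)
    (x : (X.diag.op ⋙ P).sections) {c : I} (j : X.J) (h : c ⟶ X.diag.obj j) :
    (X.descFam P x).app (op c) (X.cls j h) = P.map h.op (x.1 (op j)) :=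
  X.descFamApp_cls P x j h

lemma homColim_hom_ext {X : IndCard κ I} {P : Iᵒᵖ ⥤ Type w} {φ ψ : X.homColim ⟶ P}
    (h : ∀ j, φ.app (op (X.diag.obj j)) (X.cls j (𝟙 _)) =
      ψ.app (op (X.diag.obj j)) (X.cls j (𝟙 _))) : φ = ψ := by
  ext c y
  obtain ⟨j, f, rfl⟩ := X.exists_cls (c := c.unop) y
  have e : X.cls j f = X.homColim.map f.op (X.cls j (𝟙 _)) := by rw [map_cls, Category.comp_id]
  change φ.app (op c.unop) (X.cls j f) = ψ.app (op c.unop) (X.cls j f)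
  rw [e, NatTrans.naturality_apply, NatTrans.naturality_apply, h j]

/-- The map on `colim_j Hom(c, i_j)` induced by a morphism of `Ind_κ`-objects. -/
noncomputable def Hom.toNat {X Y : IndCard κ I} (g : Hom X Y) : X.homColim ⟶ Y.homColim :=
  X.descFam Y.homColim g.fam

lemma Hom.toNat_cls_id {X Y : IndCard κ I} (g : Hom X Y) (j : X.J) :
    g.toNat.app (op (X.diag.obj j)) (X.cls j (𝟙 _)) = g.fam.1 (op j) := by
  rw [Hom.toNat, descFam_cls]
  exact Functor.map_id_apply _ _ _

/-- The identity: the family of the classes of the identities. -/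
noncomputable def Hom.id (X : IndCard κ I) : Hom X X where
  fam := ⟨fun j => X.cls j.unop (𝟙 _), fun {j j'} a => by
    change X.homColim.map (X.diag.map a.unop).op (X.cls j.unop (𝟙 (X.diag.obj j.unop))) = _
    rw [map_cls, Category.comp_id]
    simpa using X.cls_comp (𝟙 (X.diag.obj j'.unop)) a.unop⟩

/-- The composition: if `f_j` is the class of `h : i_j ⟶ i'_j'` and `g_j'` is the class of
`h' : i'_j' ⟶ i''_j''`, then `(f ≫ g)_j` is the class of `h ≫ h'`. -/
noncomputable def Hom.comp {X Y Z : IndCard κ I} (f : Hom X Y) (g : Hom Y Z) : Hom X Z where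
  fam := ⟨fun j => g.toNat.app (op (X.diag.obj j.unop)) (f.fam.1 j), fun {j j'} a => by
    change Z.homColim.map (X.diag.map a.unop).op
      (g.toNat.app (op (X.diag.obj j.unop)) (f.fam.1 j)) = _
    rw [← NatTrans.naturality_apply]
    exact congrArg _ (f.map_fam a.unop)⟩

lemma Hom.toNat_id (X : IndCard κ I) : (Hom.id X).toNat = 𝟙 _ :=
  homColim_hom_ext fun j => Hom.toNat_cls_id (Hom.id X) j

lemma Hom.toNat_comp {X Y Z : IndCard κ I} (f : Hom X Y) (g : Hom Y Z) :
    (f.comp g).toNat = f.toNat ≫ g.toNat :=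
  homColim_hom_ext fun j => by
    rw [Hom.toNat_cls_id]
    exact congrArg (g.toNat.app (op (X.diag.obj j))) (Hom.toNat_cls_id f j).symm

lemma Hom.toNat_injective {X Y : IndCard κ I} {f g : Hom X Y} (h : f.toNat = g.toNat) : f = g :=
  Hom.ext_fam fun j => by rw [← Hom.toNat_cls_id, ← Hom.toNat_cls_id, h]

/-- The category `Ind_κ(I)`. -/
noncomputable instance : Category.{w} (IndCard κ I) where
  Hom := Hom
  id := Hom.id
  comp := Hom.comp
  id_comp f := Hom.toNat_injective (by rw [Hom.toNat_comp, Hom.toNat_id, Category.id_comp])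
  comp_id f := Hom.toNat_injective (by rw [Hom.toNat_comp, Hom.toNat_id, Category.comp_id])
  assoc f g h := Hom.toNat_injective (by simp only [Hom.toNat_comp, Category.assoc])

variable (κ I) in
/-- The functor `Ind_κ(I) ⥤ (Iᵒᵖ ⥤ Type)` extending the Yoneda embedding. -/
noncomputable def toPresheaf : IndCard κ I ⥤ Iᵒᵖ ⥤ Type w where
  obj X := X.homColim
  map f := Hom.toNat f
  map_id X := Hom.toNat_id X
  map_comp f g := Hom.toNat_comp f g

instance : (toPresheaf κ I).Faithful where
  map_injective h := Hom.toNat_injective h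

instance : (toPresheaf κ I).Full where
  map_surjective {X Y} (φ : X.homColim ⟶ Y.homColim) := by
    let g : Hom X Y := ⟨⟨fun j => φ.app (op (X.diag.obj j.unop)) (X.cls j.unop (𝟙 _)),
      fun {j j'} a => by
        have e : X.homColim.map (X.diag.map a.unop).op (X.cls j.unop (𝟙 _)) =
            X.cls j'.unop (𝟙 _) := (Hom.id X).map_fam a.unop
        change Y.homColim.map (X.diag.map a.unop).op (φ.app (op (X.diag.obj j.unop)) _) = _
        rw [← NatTrans.naturality_apply]
        exact congrArg _ e⟩⟩
    exact ⟨g, homColim_hom_ext fun j => Hom.toNat_cls_id g j⟩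

/-! ### Extension of a functor to `Ind_κ`-objects -/

section Extend

variable {D : Type v} [Category.{w} D] [HasCardinalFilteredColimits.{w} D κ] (γ : I ⥤ D)

/-- The `κ`-filtered colimit `colim_j γ(i_j)`. -/
noncomputable def extendObj (X : IndCard κ I) : D :=
  have := HasCardinalFilteredColimits.hasColimitsOfShape (κ := κ) D X.J
  colimit (X.diag ⋙ γ)

/-- The canonical map `γ(i_j) ⟶ colim_j γ(i_j)`. -/
noncomputable def extendι (X : IndCard κ I) (j : X.J) : γ.obj (X.diag.obj j) ⟶ X.extendObj γ :=
  have := HasCardinalFilteredColimits.hasColimitsOfShape (κ := κ) D X.J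
  colimit.ι (X.diag ⋙ γ) j

lemma extendι_w (X : IndCard κ I) {j j' : X.J} (a : j ⟶ j') :
    γ.map (X.diag.map a) ≫ X.extendι γ j' = X.extendι γ j :=
  have := HasCardinalFilteredColimits.hasColimitsOfShape (κ := κ) D X.J
  colimit.w (X.diag ⋙ γ) a

lemma extend_hom_ext (X : IndCard κ I) {d : D} {f g : X.extendObj γ ⟶ d}
    (h : ∀ j, X.extendι γ j ≫ f = X.extendι γ j ≫ g) : f = g :=
  have := HasCardinalFilteredColimits.hasColimitsOfShape (κ := κ) D X.J
  colimit.hom_ext h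

/-- The map `colim_j Hom(c, i_j) → Hom(γ(c), colim_j γ(i_j))` sending the class of `h : c ⟶ i_j` to
the composition of `γ(h)` and the canonical map. -/
noncomputable def extendHom (X : IndCard κ I) :
    X.homColim ⟶ γ.op ⋙ yoneda.obj (X.extendObj γ) :=
  X.descFam _ ⟨fun j => X.extendι γ j.unop, fun a => X.extendι_w γ a.unop⟩

lemma extendHom_cls (X : IndCard κ I) {c : I} (j : X.J) (h : c ⟶ X.diag.obj j) :
    (X.extendHom γ).app (op c) (X.cls j h) = γ.map h ≫ X.extendι γ j :=
  X.descFam_cls _ _ j h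

/-- The map `colim_j γ(i_j) ⟶ colim_j' γ(i'_j')` induced by a morphism of `Ind_κ`-objects. -/
noncomputable def extendMap {X Y : IndCard κ I} (f : X ⟶ Y) : X.extendObj γ ⟶ Y.extendObj γ :=
  have := HasCardinalFilteredColimits.hasColimitsOfShape (κ := κ) D X.J
  colimit.desc (X.diag ⋙ γ)
    { pt := Y.extendObj γ
      ι :=
        { app := fun j => (Y.extendHom γ).app (op (X.diag.obj j)) (Hom.fam f |>.1 (op j))
          naturality := fun j j' a => by
            have h := NatTrans.naturality_apply (Y.extendHom γ) (X.diag.map a).op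
              ((Hom.fam f).1 (op j'))
            rw [Hom.map_fam] at h
            exact h.symm.trans (Category.comp_id _).symm } }

lemma extendι_map {X Y : IndCard κ I} (f : X ⟶ Y) (j : X.J) :
    X.extendι γ j ≫ extendMap γ f =
      (Y.extendHom γ).app (op (X.diag.obj j)) ((Hom.fam f).1 (op j)) :=
  have := HasCardinalFilteredColimits.hasColimitsOfShape (κ := κ) D X.J
  colimit.ι_desc _ _

lemma extendHom_map {X Y : IndCard κ I} (f : X ⟶ Y) {c : I} (x : X.homColim.obj (op c)) :
    (X.extendHom γ).app (op c) x ≫ extendMap γ f =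
      (Y.extendHom γ).app (op c) ((Hom.toNat f).app (op c) x) := by
  obtain ⟨j, h, rfl⟩ := X.exists_cls x
  rw [extendHom_cls, Category.assoc, extendι_map, Hom.toNat, descFam_cls]
  exact (NatTrans.naturality_apply (Y.extendHom γ) h.op ((Hom.fam f).1 (op j))).symm

/-- The extension of a functor `γ : I ⥤ D` to a functor `Ind_κ(I) ⥤ D` when `D` has `κ`-filtered
colimits: it sends `i : J ⥤ I` to `colim_j γ(i_j)`. -/
noncomputable def extend : IndCard κ I ⥤ D where
  obj X := X.extendObj γ
  map f := extendMap γ f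
  map_id X := X.extend_hom_ext γ fun j => by
    rw [extendι_map]
    change (X.extendHom γ).app _ (X.cls j (𝟙 _)) = _
    rw [extendHom_cls, γ.map_id, Category.id_comp, Category.comp_id]
  map_comp {X Y Z} f g := X.extend_hom_ext γ fun j => by
    rw [extendι_map, ← Category.assoc, extendι_map, extendHom_map]
    rfl

end Extend

end Cat

/-! ### Filtered colimits in `Ind_κ(C)` -/

section Colimits

variable {κ : Cardinal.{w}} [Fact κ.IsRegular] {C : Type w} [SmallCategory C]

lemma isCardinalFiltered_elements {J : Type w} [SmallCategory J] [IsCardinalFiltered J κ]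
    (F : J ⥤ Cᵒᵖ ⥤ Type w) (c : Cocone F)
    (hs : ∀ (X : Cᵒᵖ) (x : c.pt.obj X), ∃ (j : J) (y : (F.obj j).obj X), (c.ι.app j).app X y = x)
    (he : ∀ (X : Cᵒᵖ) (j : J) (y y' : (F.obj j).obj X),
      (c.ι.app j).app X y = (c.ι.app j).app X y' →
        ∃ (j' : J) (a : j ⟶ j'), (F.map a).app X y = (F.map a).app X y')
    (hF : ∀ j, IsCardinalFiltered (F.obj j).Elementsᵒᵖ κ) :
    IsCardinalFiltered c.pt.Elementsᵒᵖ κ := by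
  have w : ∀ {j j' : J} (a : j ⟶ j') (X : Cᵒᵖ) (y : (F.obj j).obj X),
      (c.ι.app j').app X ((F.map a).app X y) = (c.ι.app j).app X y := fun a X y => by
    rw [← c.w a]; rfl
  rw [isCardinalFiltered_iff]
  constructor
  · intro ι e hι
    choose j y hy using fun i => hs (e i).unop.1 (e i).unop.2
    let m := IsCardinalFiltered.max j hι
    let t : ∀ i, j i ⟶ m := IsCardinalFiltered.toMax j hι
    have := hF m
    let e' : ι → (F.obj m).Elementsᵒᵖ := fun i => op ⟨(e i).unop.1, (F.map (t i)).app _ (y i)⟩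
    let k := IsCardinalFiltered.max e' hι
    refine ⟨op ⟨k.unop.1, (c.ι.app m).app _ k.unop.2⟩, fun i => ?_⟩
    let f := (IsCardinalFiltered.toMax e' hι i).unop
    refine ⟨(show Functor.elementsMk c.pt _ _ ⟶ (e i).unop from ⟨f.1, ?_⟩).op⟩
    change c.pt.map f.1 ((c.ι.app m).app _ k.unop.2) = (e i).unop.2
    rw [← NatTrans.naturality_apply]
    exact (congrArg _ f.2).trans ((w (t i) _ _).trans (hy i))
  · intro ι e e' f hι
    have := isFiltered_of_isCardinalFiltered J κ
    obtain ⟨j, x, x', hx, hx'⟩ : ∃ (j : J) (x : (F.obj j).obj e.unop.1)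
        (x' : (F.obj j).obj e'.unop.1), (c.ι.app j).app _ x = e.unop.2 ∧
          (c.ι.app j).app _ x' = e'.unop.2 := by
      obtain ⟨j₁, x, hx⟩ := hs _ e.unop.2
      obtain ⟨j₂, x', hx'⟩ := hs _ e'.unop.2
      exact ⟨IsFiltered.max j₁ j₂, (F.map (IsFiltered.leftToMax _ _)).app _ x,
        (F.map (IsFiltered.rightToMax _ _)).app _ x', (w (IsFiltered.leftToMax j₁ j₂) _ _).trans hx,
        (w (IsFiltered.rightToMax j₁ j₂) _ _).trans hx'⟩
    have h : ∀ i, ∃ (j' : J) (a : j ⟶ j'),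
        (F.map a).app _ ((F.obj j).map (f i).unop.1 x') = (F.map a).app _ x := fun i => by
      apply he
      rw [NatTrans.naturality_apply, hx, hx']
      exact (f i).unop.2
    choose j' a ha using h
    obtain ⟨m, b, d, hd⟩ := IsCardinalFiltered.wideSpan a hι
    have hd' : ∀ i, (F.obj m).map (f i).unop.1 ((F.map d).app _ x') = (F.map d).app _ x :=
      fun i => by
        rw [← NatTrans.naturality_apply, ← hd i, Functor.map_comp]
        exact congrArg ((F.map (b i)).app e.unop.1) (ha i)
    have := hF m
    let p : (F.obj m).Elementsᵒᵖ := op ⟨e.unop.1, (F.map d).app _ x⟩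
    let p' : (F.obj m).Elementsᵒᵖ := op ⟨e'.unop.1, (F.map d).app _ x'⟩
    let g : ι → (p ⟶ p') := fun i => (show p'.unop ⟶ p.unop from ⟨(f i).unop.1, hd' i⟩).op
    let l := IsCardinalFiltered.coeq g hι
    let u := (IsCardinalFiltered.coeqHom g hι).unop
    let v := (IsCardinalFiltered.toCoeq g hι).unop
    have huv : ∀ i, u.1 ≫ (f i).unop.1 = v.1 := fun i =>
      congrArg (fun z => z.unop.1) (IsCardinalFiltered.coeq_condition g hι i)
    refine ⟨op ⟨l.unop.1, (c.ι.app m).app _ l.unop.2⟩,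
      (show Functor.elementsMk c.pt _ _ ⟶ e'.unop from ⟨u.1, ?_⟩).op,
      (show Functor.elementsMk c.pt _ _ ⟶ e.unop from ⟨v.1, ?_⟩).op, fun i => ?_⟩
    · change c.pt.map u.1 ((c.ι.app m).app _ l.unop.2) = e'.unop.2
      rw [← NatTrans.naturality_apply]
      exact (congrArg _ u.2).trans ((w d _ _).trans hx')
    · change c.pt.map v.1 ((c.ι.app m).app _ l.unop.2) = e.unop.2
      rw [← NatTrans.naturality_apply]
      exact (congrArg _ v.2).trans ((w d _ _).trans hx)
    · apply Quiver.Hom.unop_inj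
      apply Subtype.ext
      exact huv i

instance (X : IndCard κ C) : IsCardinalFiltered X.homColim.Elementsᵒᵖ κ := by
  have := isFiltered_of_isCardinalFiltered X.J κ
  refine isCardinalFiltered_elements (X.diag ⋙ yoneda)
    { pt := X.homColim
      ι :=
        { app := fun j =>
            { app := fun c => TypeCat.ofHom fun h : c.unop ⟶ X.diag.obj j => X.cls j h
              naturality := fun c c' f => by
                ext h
                exact (X.map_cls f.unop j h).symm }
          naturality := fun j j' a => by
            ext c h
            exact X.cls_comp h a } }
    (fun c x => X.exists_cls (c := c.unop) x) (fun c j y y' h => ?_) (fun j => ?_)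
  · exact (Types.FilteredColimit.isColimit_eq_iff'
      (colimit.isColimit (X.diag ⋙ coyoneda.obj c)) y y').1 h
  · exact (Functor.Elements.isInitial (X.diag.obj j)).op.isCardinalFiltered κ

/-- The `Ind_κ`-object given by the elements of a presheaf. -/
def ofPresheaf (P : Cᵒᵖ ⥤ Type w) [IsCardinalFiltered P.Elementsᵒᵖ κ] : IndCard κ C where
  J := P.Elementsᵒᵖ
  diag := (CategoryOfElements.π P).leftOp

/-- A presheaf is the colimit of the representable presheaves indexed by its elements. -/
noncomputable def ofPresheafIso (P : Cᵒᵖ ⥤ Type w) [IsCardinalFiltered P.Elementsᵒᵖ κ] :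
    (toPresheaf κ C).obj (ofPresheaf P) ≅ P :=
  let x : ((ofPresheaf (κ := κ) P).diag.op ⋙ P).sections :=
    ⟨fun e => e.unop.unop.2, fun {e e'} a => a.unop.unop.2⟩
  let φ : (ofPresheaf (κ := κ) P).homColim ⟶ P := descFam _ P x
  have hφ : ∀ {c : C} (e : P.Elementsᵒᵖ) (h : c ⟶ e.unop.1.unop),
      φ.app (op c) ((ofPresheaf (κ := κ) P).cls e h) = P.map h.op e.unop.2 :=
    fun e h => descFam_cls (ofPresheaf (κ := κ) P) P x e h
  have key : ∀ {c : C} (e : P.Elementsᵒᵖ) (h : c ⟶ e.unop.1.unop),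
      (ofPresheaf (κ := κ) P).cls e h =
        (ofPresheaf (κ := κ) P).cls (op (P.elementsMk (op c) (P.map h.op e.unop.2))) (𝟙 c) :=
    fun {c} e h => by
      let a : op (P.elementsMk (op c) (P.map h.op e.unop.2)) ⟶ e :=
        (show e.unop ⟶ P.elementsMk (op c) (P.map h.op e.unop.2) from ⟨h.op, rfl⟩).op
      have := (ofPresheaf (κ := κ) P).cls_comp (𝟙 c) a
      exact (congrArg ((ofPresheaf (κ := κ) P).cls e) (Category.id_comp h)).symm.trans this
  have : IsIso φ := by
    rw [NatTrans.isIso_iff_isIso_app]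
    intro c
    rw [isIso_iff_bijective]
    constructor
    · intro x y hxy
      obtain ⟨e, h, rfl⟩ := exists_cls (c := c.unop) _ x
      obtain ⟨e', h', rfl⟩ := exists_cls (c := c.unop) _ y
      have hxy' : P.map h.op e.unop.2 = P.map h'.op e'.unop.2 :=
        (hφ e h).symm.trans (hxy.trans (hφ e' h'))
      exact (key e h).trans ((congrArg (fun z => (ofPresheaf (κ := κ) P).cls
        (op (P.elementsMk c z)) (𝟙 c.unop)) hxy').trans (key e' h').symm)
    · intro x
      exact ⟨(ofPresheaf (κ := κ) P).cls (op (P.elementsMk c x)) (𝟙 c.unop),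
        (hφ _ _).trans (Functor.map_id_apply _ _ _)⟩
  show (ofPresheaf (κ := κ) P).homColim ≅ P from asIso φ

instance : HasCardinalFilteredColimits.{w} (IndCard κ C) κ where
  hasColimitsOfShape J _ _ :=
    { has_colimit := fun K => by
        have := isFiltered_of_isCardinalFiltered J κ
        let c := colimit.cocone (K ⋙ toPresheaf κ C)
        have hc : ∀ X, IsColimit (((evaluation _ _).obj X).mapCocone c) := fun X =>
          isColimitOfPreserves _ (colimit.isColimit _)
        have : IsCardinalFiltered c.pt.Elementsᵒᵖ κ :=
          isCardinalFiltered_elements (K ⋙ toPresheaf κ C) c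
            (fun X x => Types.jointly_surjective _ (hc X) x)
            (fun X j y y' h => (Types.FilteredColimit.isColimit_eq_iff' (hc X) y y').1 h)
            (fun j => inferInstanceAs (IsCardinalFiltered (K.obj j).homColim.Elementsᵒᵖ κ))
        have := createsColimitOfFullyFaithfulOfIso (K := K) (F := toPresheaf κ C)
          (ofPresheaf c.pt) (ofPresheafIso c.pt)
        exact hasColimit_of_created K (toPresheaf κ C) }

end Colimits

/-- The full subcategory `Ind_κ^μ(C) ⊆ Ind_κ(C)` of `μ`-compact objects. -/
abbrev Comp (κ μ : Cardinal.{w}) [Fact κ.IsRegular] [Fact μ.IsRegular]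
    (C : Type w) [SmallCategory C] : Type (w + 1) :=
  (isCardinalPresentable (IndCard κ C) μ).FullSubcategory

lemma hasCardinalFilteredColimits_of_le (κ μ : Cardinal.{w}) [Fact κ.IsRegular]
    [Fact μ.IsRegular] (h : κ ≤ μ) (C : Type w) [SmallCategory C] :
    HasCardinalFilteredColimits.{w} (IndCard κ C) μ where
  hasColimitsOfShape J _ _ := by
    have := IsCardinalFiltered.of_le J h
    exact HasCardinalFilteredColimits.hasColimitsOfShape (κ := κ) _ J

/-- The canonical embedding `Ind_μ(Ind_κ^μ(C)) ⥤ Ind_κ(C)` extending the inclusion of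
`Ind_κ^μ(C)`. -/
noncomputable def canonical (κ μ : Cardinal.{w}) [Fact κ.IsRegular] [Fact μ.IsRegular]
    (h : κ ≤ μ) (C : Type w) [SmallCategory C] : IndCard μ (Comp κ μ C) ⥤ IndCard κ C :=
  have := hasCardinalFilteredColimits_of_le κ μ h C
  extend (isCardinalPresentable (IndCard κ C) μ).ι

end IndCard

/-!
The canonical functor `Ind_μ(Ind_κ^μ(C)) ⥤ Ind_κ(C)` is always fully faithful: for a `μ`-compact
object `c` and a `μ`-filtered diagram, the map `colim_j Hom(c, i_j) → Hom(c, colim_j i_j)` is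
bijective (`extendHom_app_bijective`). So it is an equivalence if and only if every object of
`Ind_κ(C)` is a `μ`-filtered colimit of `μ`-compact objects.

If `κ ◁ μ`, an `Ind_κ`-object may be reindexed by a `κ`-directed poset `P`. Every subset of `P` of
cardinality `< μ` lies in a `κ`-directed subset of cardinality `< μ`, by a closure process of length
`κ` that Mathlib carries out in
`Cardinal.SharplyLT.exists_isCardinalFiltered_set_of_exists_cofinal`. Hence the `κ`-directed
subsets of cardinality `< μ` form a `μ`-directed poset (`isCardinalFiltered_subsets`). The given
object is the colimit of its restrictions to these subsets (`isColimitSubsetsCocone`), and each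
restriction is `μ`-compact, being a colimit of fewer than `μ` representable objects
(`isCardinalPresentable_of_hasCardinalLT_arrow`).

Conversely, let `|S| < μ`, and let `J` be the poset `P_κ(S)` with a greatest element adjoined. For
`C` take the poset of subsets of `J` of cardinality `< κ` with a greatest element. Then `Ind_κ(C)`
is equivalent to the poset of `κ`-directed subsets of `J`, an object being determined by its support
(`supp`, `nonempty_hom_of_supp_subset`, `supp_ofSet`), and the support of a `μ`-compact object has
cardinality `< μ` (`hasCardinalLT_supp`; the adjoined element is needed here). If `P_κ(S)`, as a
subset of `J`, is a `μ`-filtered colimit of `μ`-compact objects, then one of these contains the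
fewer than `μ` singletons. Its support is a `κ`-directed subset of `P_κ(S)` of cardinality `< μ`;
it contains an upper bound of any family of fewer than `κ` singletons, so it is cofinal.
-/

namespace IndCard

/-! ### Full faithfulness of the extension of a functor -/

section FullyFaithful

variable {κ : Cardinal.{w}} [Fact κ.IsRegular] {I : Type u} [Category.{w} I]
  {D : Type v} [Category.{w} D] [HasCardinalFilteredColimits.{w} D κ] (γ : I ⥤ D)

/-- The colimit cocone of the diagram `j ↦ γ(i_j)` with point `extendObj`. -/
noncomputable def extendCocone (X : IndCard κ I) : Cocone (X.diag ⋙ γ) where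
  pt := X.extendObj γ
  ι :=
    { app := X.extendι γ
      naturality := fun _ _ a => (X.extendι_w γ a).trans (Category.comp_id _).symm }

noncomputable def isColimitExtendCocone (X : IndCard κ I) : IsColimit (X.extendCocone γ) :=
  have := HasCardinalFilteredColimits.hasColimitsOfShape (κ := κ) D X.J
  IsColimit.ofIsoColimit (colimit.isColimit (X.diag ⋙ γ))
    (Cocone.ext (Iso.refl _) fun _ => Category.comp_id _)

variable [γ.Full] [γ.Faithful] [∀ c, IsCardinalPresentable (γ.obj c) κ]

/-- Compactness of `γ(c)`: the comparison map `colim_j Hom(c, i_j) → Hom(γ(c), colim_j γ(i_j))` is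
bijective. -/
lemma extendHom_app_bijective (X : IndCard κ I) (c : I) :
    Function.Bijective ((X.extendHom γ).app (op c)) := by
  constructor
  · intro x y hxy
    obtain ⟨j, h, rfl⟩ := X.exists_cls x
    obtain ⟨j', h', rfl⟩ := X.exists_cls y
    rw [extendHom_cls, extendHom_cls] at hxy
    obtain ⟨k, a, b, hab⟩ := IsCardinalPresentable.exists_eq_of_isColimit (X := γ.obj c) κ
      (X.isColimitExtendCocone γ) (γ.map h) (γ.map h') hxy
    have e : h ≫ X.diag.map a = h' ≫ X.diag.map b := γ.map_injective (by simpa using hab)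
    rw [← X.cls_comp h a, e, X.cls_comp]
  · intro g
    obtain ⟨j, f, hf⟩ := IsCardinalPresentable.exists_hom_of_isColimit (X := γ.obj c) κ
      (X.isColimitExtendCocone γ) g
    obtain ⟨h, rfl⟩ := γ.map_surjective f
    exact ⟨X.cls j h, (X.extendHom_cls γ j h).trans hf⟩

/-- Faithfulness is the injectivity in `extendHom_app_bijective`. -/
lemma extend_faithful : (extend (κ := κ) γ).Faithful where
  map_injective {X Y f g} hfg := Hom.ext_fam fun j =>
    (extendHom_app_bijective γ Y _).1 <| by
      rw [← extendι_map, ← extendι_map]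
      exact congrArg (X.extendι γ j ≫ ·) hfg

/-- Fullness: the components of a morphism of colimits lift uniquely to elements of the colimits
`colim_j' Hom(i_j, i'_j')`, so that the lifts are compatible. -/
lemma extend_full : (extend (κ := κ) γ).Full where
  map_surjective {X Y} φ := by
    change X.extendObj γ ⟶ Y.extendObj γ at φ
    choose x hx using fun j => (extendHom_app_bijective γ Y (X.diag.obj j)).2 (X.extendι γ j ≫ φ)
    let f : X ⟶ Y := Hom.mk ⟨fun j => x j.unop, fun {j j'} a => by
      apply (extendHom_app_bijective γ Y _).1
      change (Y.extendHom γ).app (op (X.diag.obj j'.unop))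
        (Y.homColim.map (X.diag.map a.unop).op (x j.unop)) = _
      rw [NatTrans.naturality_apply, hx, hx]
      change γ.map (X.diag.map a.unop) ≫ _ ≫ _ = _
      rw [← Category.assoc, extendι_w]⟩
    exact ⟨f, X.extend_hom_ext γ fun j => (extendι_map γ f j).trans (hx j)⟩

end FullyFaithful

/-! ### Representable objects and compactness of small diagrams -/

section Compact

variable {κ : Cardinal.{w}} [Fact κ.IsRegular] {C : Type w} [SmallCategory C]

/-- The `κ`-filtered colimits of `Ind_κ(C)` are computed in presheaves: they are created by
`toPresheaf`. -/
instance (J : Type w) [SmallCategory J] [IsCardinalFiltered J κ] :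
    PreservesColimitsOfShape J (toPresheaf κ C) where
  preservesColimit {K} := by
    have := isFiltered_of_isCardinalFiltered J κ
    let c := colimit.cocone (K ⋙ toPresheaf κ C)
    have hc : ∀ X, IsColimit (((evaluation _ _).obj X).mapCocone c) := fun X =>
      isColimitOfPreserves _ (colimit.isColimit _)
    have : IsCardinalFiltered c.pt.Elementsᵒᵖ κ :=
      isCardinalFiltered_elements (K ⋙ toPresheaf κ C) c
        (fun X x => Types.jointly_surjective _ (hc X) x)
        (fun X j y y' h => (Types.FilteredColimit.isColimit_eq_iff' (hc X) y y').1 h)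
        (fun j => inferInstanceAs (IsCardinalFiltered (K.obj j).homColim.Elementsᵒᵖ κ))
    have := createsColimitOfFullyFaithfulOfIso (K := K) (F := toPresheaf κ C)
      (ofPresheaf c.pt) (ofPresheafIso c.pt)
    infer_instance

variable (κ) in
/-- The `Ind_κ`-object attached to an object of `C`: the diagram of shape a point. -/
def const (c : C) : IndCard κ C where
  J := Discrete PUnit.{w + 1}
  filtered := isCardinalFiltered_of_hasTerminal _ _
  diag := (Functor.const _).obj c

/-- The morphism out of `const κ c` given by an element of `colim_j Hom(c, i_j)`. -/
noncomputable def ofElt {X : IndCard κ C} {c : C} (x : X.homColim.obj (op c)) : const κ c ⟶ X :=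
  Hom.mk ⟨fun _ => x, fun _ => X.homColim.map_id_apply (op c) x⟩

/-- The element of `colim_j Hom(c, i_j)` given by a morphism out of `const κ c`. -/
noncomputable def toElt {X : IndCard κ C} {c : C} (f : const κ c ⟶ X) : X.homColim.obj (op c) :=
  (Hom.fam f).1 (op ⟨⟨⟩⟩)

lemma ofElt_toElt {X : IndCard κ C} {c : C} (f : const κ c ⟶ X) : ofElt (toElt f) = f :=
  Hom.ext_fam fun _ => rfl

lemma ofElt_comp {X Y : IndCard κ C} {c : C} (x : X.homColim.obj (op c)) (f : X ⟶ Y) :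
    ofElt x ≫ f = ofElt ((Hom.toNat f).app (op c) x) := rfl

variable (κ C) in
/-- The functor `C ⥤ Ind_κ(C)` sending an object to the diagram of shape a point. -/
noncomputable def constFunctor : C ⥤ IndCard κ C where
  obj := const κ
  map {c c'} f := ofElt ((const κ c').cls ⟨⟨⟩⟩ f)
  map_id c := rfl
  map_comp {c c' c''} f g := by
    rw [ofElt_comp]
    exact congrArg ofElt
      ((descFam_cls (const κ c') _ _ _ f).trans ((const κ c'').map_cls f _ g)).symm

lemma constFunctor_map_comp_ofElt {X : IndCard κ C} {c c' : C} (f : c ⟶ c')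
    (x : X.homColim.obj (op c')) :
    (constFunctor κ C).map f ≫ ofElt x = ofElt (X.homColim.map f.op x) := by
  change ofElt _ ≫ ofElt x = _
  rw [ofElt_comp]
  exact congrArg ofElt (descFam_cls _ _ _ _ _)

/-- The functor corepresented by `const κ c` is `i_• ↦ colim_j Hom(c, i_j)`. -/
noncomputable def coyonedaConstIso (c : C) :
    toPresheaf κ C ⋙ (evaluation _ _).obj (op c) ≅ coyoneda.obj (op (const κ c)) :=
  NatIso.ofComponents (fun X => Equiv.toIso
    { toFun := fun x => ofElt x
      invFun := toElt
      left_inv := fun _ => rfl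
      right_inv := ofElt_toElt })
    (fun f => by ext x; rfl)

instance (c : C) : IsCardinalPresentable (const κ c) κ where
  preservesColimitOfShape _ _ _ := preservesColimitsOfShape_of_natIso (coyonedaConstIso c)

/-- The cocone exhibiting an `Ind_κ`-object as the colimit of its own diagram. -/
noncomputable def selfCocone (X : IndCard κ C) : Cocone (X.diag ⋙ constFunctor κ C) where
  pt := X
  ι :=
    { app := fun j => ofElt (X.cls j (𝟙 _))
      naturality := fun j j' a => by
        refine (constFunctor_map_comp_ofElt _ _).trans ?_
        exact (congrArg ofElt ((Hom.id X).map_fam a)).trans (Category.comp_id _).symm }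

/-- An `Ind_κ`-object is the colimit of its own diagram. -/
noncomputable def isColimitSelfCocone (X : IndCard κ C) : IsColimit X.selfCocone where
  desc s := Hom.mk ⟨fun j => toElt (s.ι.app j.unop), fun {j j'} a => by
    exact congrArg toElt ((constFunctor_map_comp_ofElt (X := s.pt) (X.diag.map a.unop)
      (toElt (s.ι.app j.unop))).symm.trans (s.w a.unop))⟩
  fac s j :=
    (ofElt_comp _ _).trans
      ((congrArg ofElt (Hom.toNat_cls_id _ j)).trans (ofElt_toElt (s.ι.app j)))
  uniq s m hm := Hom.ext_fam fun j =>
    (Hom.toNat_cls_id m j).symm.trans (congrArg toElt (hm j))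

/-- An `Ind_κ`-object with fewer than `μ` morphisms in its index category is a `μ`-small colimit of
`κ`-compact objects, hence `μ`-compact. -/
lemma isCardinalPresentable_of_hasCardinalLT_arrow {μ : Cardinal.{w}} [Fact μ.IsRegular]
    (h : κ ≤ μ) (X : IndCard κ C) (hX : HasCardinalLT (Arrow X.J) μ) :
    IsCardinalPresentable X μ := by
  have : ∀ j, IsCardinalPresentable ((X.diag ⋙ constFunctor κ C).obj j) μ := fun j =>
    isCardinalPresentable_of_le (κ := κ) (const κ (X.diag.obj j)) h
  exact isCardinalPresentable_of_isColimit X.selfCocone X.isColimitSelfCocone μ hX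

end Compact

/-! ### Reindexing of `Ind_κ`-objects -/

section Restrict

variable {κ : Cardinal.{w}} [Fact κ.IsRegular] {C : Type w} [SmallCategory C]

/-- The reindexing of an `Ind_κ`-object along a functor from a `κ`-filtered category. -/
def restrict (X : IndCard κ C) {A : Type w} [SmallCategory A] [IsCardinalFiltered A κ]
    (F : A ⥤ X.J) : IndCard κ C where
  J := A
  diag := F ⋙ X.diag

/-- The canonical morphism from a reindexed `Ind_κ`-object to the original one. -/
noncomputable def restrictHom (X : IndCard κ C) {A : Type w} [SmallCategory A]
    [IsCardinalFiltered A κ] (F : A ⥤ X.J) : X.restrict F ⟶ X :=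
  Hom.mk ⟨fun a => X.cls (F.obj a.unop) (𝟙 _), fun f =>
    (Hom.id X).map_fam (F.map f.unop)⟩

/-- Reindexing along a final functor does not change an `Ind_κ`-object. -/
lemma isIso_restrictHom (X : IndCard κ C) {A : Type w} [SmallCategory A]
    [IsCardinalFiltered A κ] (F : A ⥤ X.J) [F.Final] : IsIso (X.restrictHom F) := by
  have : IsIso ((toPresheaf κ C).map (X.restrictHom F)) := by
    rw [NatTrans.isIso_iff_isIso_app]
    intro c
    have e : ((toPresheaf κ C).map (X.restrictHom F)).app c =
        colimit.pre (X.diag ⋙ coyoneda.obj c) F := by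
      ext x
      obtain ⟨j, h, rfl⟩ := exists_cls (c := c.unop) (X.restrict F) x
      refine (descFam_cls _ _ _ _ _).trans ((X.map_cls _ _ _).trans ?_)
      refine Eq.trans ?_ (congr($(colimit.ι_pre (X.diag ⋙ coyoneda.obj c) F j) h)).symm
      exact congrArg (X.cls _) (Category.comp_id h)
    rw [e]
    exact inferInstanceAs (IsIso (colimit.pre (X.diag ⋙ coyoneda.obj c) F))
  exact isIso_of_reflects_iso _ (toPresheaf κ C)

end Restrict

/-! ### Colimits of restrictions to subsets -/

section Subsets

variable {κ : Cardinal.{w}} [Fact κ.IsRegular] {C : Type w} [SmallCategory C]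
  (X : IndCard κ C) {P : Type w} [PartialOrder P] [IsCardinalFiltered P κ] (F : P ⥤ X.J)
  (Q : Set P → Prop) [hQ : ∀ A : Subtype Q, IsCardinalFiltered A.1 κ]

/-- The inclusion functor of a subset of a poset. -/
def inclusionFunctor (A : Set P) : A ⥤ P := (Subtype.mono_coe (· ∈ A)).functor

/-- The restriction of an `Ind_κ`-object to a subset of a poset mapping to its index category. -/
noncomputable abbrev restrictSubset (A : Subtype Q) : IndCard κ C :=
  X.restrict (inclusionFunctor A.1 ⋙ F)

/-- The morphism between the restrictions to two subsets given by an inclusion. -/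
noncomputable def subsetsMap {A B : Subtype Q} (h : A ≤ B) :
    X.restrictSubset F Q A ⟶ X.restrictSubset F Q B :=
  Hom.mk ⟨fun a => (X.restrictSubset F Q B).cls (⟨a.unop.1, h a.unop.2⟩ : B.1) (𝟙 _),
    fun {a a'} f => (Hom.id (X.restrictSubset F Q B)).map_fam
      (homOfLE (show a'.unop.1 ≤ a.unop.1 from leOfHom (X := A.1) f.unop) :
        (⟨a'.unop.1, h a'.unop.2⟩ : B.1) ⟶ ⟨a.unop.1, h a.unop.2⟩)⟩

omit [IsCardinalFiltered P κ] in
lemma fam_subsetsMap_comp {A B : Subtype Q} (h : A ≤ B) {Z : IndCard κ C}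
    (f : X.restrictSubset F Q B ⟶ Z) (a : A.1) :
    (Hom.fam (X.subsetsMap F Q h ≫ f)).1 (op a) =
      (Hom.fam f).1 (op (⟨a.1, h a.2⟩ : B.1)) :=
  Hom.toNat_cls_id (X := X.restrictSubset F Q B) f (⟨a.1, h a.2⟩ : B.1)

/-- The diagram of the restrictions of an `Ind_κ`-object to a family of `κ`-directed subsets. -/
noncomputable def subsetsFunctor : Subtype Q ⥤ IndCard κ C where
  obj := X.restrictSubset F Q
  map i := X.subsetsMap F Q (leOfHom i)
  map_id _ := rfl
  map_comp i i' := Hom.ext_fam fun a =>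
    (X.fam_subsetsMap_comp F Q (leOfHom i) (X.subsetsMap F Q (leOfHom i')) a).symm

/-- The cocone from the restrictions to subsets to the restriction to the whole poset. -/
noncomputable def subsetsCocone : Cocone (X.subsetsFunctor F Q) where
  pt := X.restrict F
  ι :=
    { app := fun A => (X.restrict F).restrictHom (inclusionFunctor A.1)
      naturality := fun A B i => by
        have e : X.subsetsMap F Q (leOfHom i) ≫
            (X.restrict F).restrictHom (inclusionFunctor B.1) =
              (X.restrict F).restrictHom (inclusionFunctor A.1) :=
          Hom.ext_fam fun a => X.fam_subsetsMap_comp F Q (leOfHom i) _ a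
        exact e.trans (Category.comp_id _).symm }

omit [IsCardinalFiltered P κ] in
/-- The components at an element `p` of a cocone over `subsetsFunctor` do not depend on the choice
of a subset containing `p`. -/
lemma subsetsFunctor_cocone_fam_eq [IsDirectedOrder (Subtype Q)]
    (s : Cocone (X.subsetsFunctor F Q)) (A B : Subtype Q) (p : P) (hA : p ∈ A.1)
    (hB : p ∈ B.1) :
    (Hom.fam (s.ι.app A)).1 (op (⟨p, hA⟩ : A.1)) =
      (Hom.fam (s.ι.app B)).1 (op (⟨p, hB⟩ : B.1)) := by
  have h : ∀ (A B : Subtype Q) (_ : A ≤ B) (p : P)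
      (hA : p ∈ A.1) (hB : p ∈ B.1), (Hom.fam (s.ι.app A)).1 (op (⟨p, hA⟩ : A.1)) =
        (Hom.fam (s.ι.app B)).1 (op (⟨p, hB⟩ : B.1)) := fun A B hAB p hA hB =>
    (congrArg (fun f : X.restrictSubset F Q A ⟶ s.pt => (Hom.fam f).1 (op (⟨p, hA⟩ : A.1)))
      (s.w (homOfLE hAB))).symm.trans (X.fam_subsetsMap_comp F Q hAB (s.ι.app B) ⟨p, hA⟩)
  obtain ⟨D, hAD, hBD⟩ := exists_ge_ge A B
  exact (h A D hAD p hA (hAD hA)).trans (h B D hBD p hB (hBD hB)).symm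

variable [IsDirectedOrder (Subtype Q)]

/-- If the family of subsets is directed and covers the poset, the restriction to the whole poset is
the colimit of the restrictions to the subsets: morphisms out of either are compatible families
indexed by the poset. -/
noncomputable def isColimitSubsetsCocone (hcov : ∀ p q : P, ∃ A, Q A ∧ p ∈ A ∧ q ∈ A) :
    IsColimit (X.subsetsCocone F Q) := by
  choose A hA hp using fun p => hcov p p
  let fam (s : Cocone (X.subsetsFunctor F Q)) (p : P) :
      s.pt.homColim.obj (op (X.diag.obj (F.obj p))) :=
    (Hom.fam (s.ι.app ⟨A p, hA p⟩)).1 (op (⟨p, (hp p).1⟩ : A p))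
  have hfam (s : Cocone (X.subsetsFunctor F Q)) (B : Subtype Q) (p : P) (hpB : p ∈ B.1) :
      fam s p = (Hom.fam (s.ι.app B)).1 (op (⟨p, hpB⟩ : B.1)) :=
    X.subsetsFunctor_cocone_fam_eq F Q s _ _ _ _ _
  have hmap (s : Cocone (X.subsetsFunctor F Q)) (p q : P) (f : p ⟶ q) :
      s.pt.homColim.map (X.diag.map (F.map f)).op (fam s q) = fam s p := by
    obtain ⟨B, hB, hpB, hqB⟩ := hcov p q
    rw [hfam s ⟨B, hB⟩ p hpB, hfam s ⟨B, hB⟩ q hqB]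
    exact Hom.map_fam (X := X.restrictSubset F Q ⟨B, hB⟩) (s.ι.app ⟨B, hB⟩)
      (homOfLE (leOfHom f) : (⟨p, hpB⟩ : B) ⟶ ⟨q, hqB⟩)
  let desc (s : Cocone (X.subsetsFunctor F Q)) : X.restrict F ⟶ s.pt :=
    Hom.mk ⟨fun p => fam s p.unop, fun f => hmap s _ _ f.unop⟩
  have fam_restrictHom_comp {Z : IndCard κ C} (B : Subtype Q) (m : X.restrict F ⟶ Z) (p : B.1) :
      (Hom.fam ((X.restrict F).restrictHom (inclusionFunctor B.1) ≫ m)).1 (op p) =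
        (Hom.fam m).1 (op p.1) :=
    Hom.toNat_cls_id (X := X.restrict F) m p.1
  exact
    { desc := desc
      fac := fun s B => Hom.ext_fam fun p =>
        (fam_restrictHom_comp B (desc s) p).trans (hfam s B p.1 p.2)
      uniq := fun s m hm => Hom.ext_fam fun p =>
        (fam_restrictHom_comp ⟨A p, hA p⟩ m ⟨p, (hp p).1⟩).symm.trans
          (congrArg (fun f : X.restrictSubset F Q ⟨A p, hA p⟩ ⟶ s.pt =>
            (Hom.fam f).1 (op (⟨p, (hp p).1⟩ : A p))) (hm ⟨A p, hA p⟩)) }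

end Subsets

/-! ### Essential surjectivity when `κ ◁ μ` -/

section EssSurj

variable {κ μ : Cardinal.{w}} [Fact κ.IsRegular] [Fact μ.IsRegular]

lemma hasCardinalLT_arrow_of_preorder {A : Type w} [Preorder A] (hA : HasCardinalLT A μ) :
    HasCardinalLT (Arrow A) μ :=
  (hasCardinalLT_prod (Cardinal.IsRegular.aleph0_le Fact.out) hA hA).of_injective
    (fun f => (f.left, f.right)) fun f g h => by
      obtain ⟨a, b, f⟩ := f
      obtain ⟨a', b', g⟩ := g
      obtain ⟨rfl, rfl⟩ : a = a' ∧ b = b' := by simpa using h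
      exact congrArg Arrow.mk (Subsingleton.elim f g)

/-- If `κ ◁ μ`, the `κ`-directed subsets of cardinality `< μ` of a `κ`-directed poset form a
`μ`-directed poset. -/
lemma isCardinalFiltered_subsets (h : κ < μ) (hs : SharplySmaller κ μ) (P : Type w)
    [PartialOrder P] [IsCardinalFiltered P κ] :
    IsCardinalFiltered {A : Set P // IsCardinalFiltered A κ ∧ HasCardinalLT A μ} μ :=
  isCardinalFiltered_preorder _ _ fun K f hK => by
    have hU : HasCardinalLT (⋃ k, (f k).1) μ :=
      hasCardinalLT_iUnion _ (by rwa [hasCardinalLT_iff_cardinal_mk_lt]) fun k => (f k).2.2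
    obtain ⟨B, hB, hB', hB''⟩ := Cardinal.SharplyLT.exists_isCardinalFiltered_set_of_exists_cofinal
      h (fun S hS => by
        rw [hasCardinalLT_iff_cardinal_mk_lt] at hS
        -- Mathlib phrases smallness by `HasCardinalLT`, which gives a propositionally equal subtype.
        have key : ∀ p : Set S → Prop, (fun T : Set S => Cardinal.mk T < κ) = p →
            ∃ U : Set (Subtype p), HasCardinalLT U μ ∧ IsCofinal U := by
          rintro _ rfl
          obtain ⟨U, hU, hU'⟩ := hs S hS
          exact ⟨U, (hasCardinalLT_iff_cardinal_mk_lt _ _).2 hU', hU⟩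
        exact key _ (funext fun T => propext (hasCardinalLT_iff_cardinal_mk_lt _ _).symm)) _ hU
    exact ⟨⟨B, hB', hB''⟩, fun k => (Set.subset_iUnion (fun k => (f k).1) k).trans hB⟩

/-- If `κ ◁ μ`, every `Ind_κ`-object, reindexed by a `κ`-directed poset, is the `μ`-filtered colimit
of its restrictions to the `κ`-directed subsets of cardinality `< μ`. -/
lemma canonical_essSurj (h : κ < μ) (hs : SharplySmaller κ μ) (C : Type w) [SmallCategory C] :
    (canonical κ μ h.le C).EssSurj where
  mem_essImage X := by
    obtain ⟨P, _, _, F, _⟩ := IsCardinalFiltered.exists_cardinal_directed X.J κ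
    let Q : Set P → Prop := fun A => IsCardinalFiltered A κ ∧ HasCardinalLT A μ
    have hQ : ∀ A : Subtype Q, IsCardinalFiltered A.1 κ := fun A => A.2.1
    have hf : IsCardinalFiltered (Subtype Q) μ := isCardinalFiltered_subsets h hs P
    have := isFiltered_of_isCardinalFiltered (Subtype Q) μ
    have hd : IsDirectedOrder (Subtype Q) := IsFiltered.isDirectedOrder _
    have hcov : ∀ p q : P, ∃ A, Q A ∧ p ∈ A ∧ q ∈ A := by
      intro p q
      have hsing : ∀ p : P, Q {p} := fun p =>
        ⟨isCardinalFiltered_preorder _ _ fun K f _ => ⟨⟨p, rfl⟩, fun k => (f k).2.le⟩,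
          hasCardinalLT_of_finite _ _ (Cardinal.IsRegular.aleph0_le Fact.out)⟩
      obtain ⟨D, hp, hq⟩ := exists_ge_ge (⟨_, hsing p⟩ : Subtype Q) ⟨_, hsing q⟩
      exact ⟨D.1, D.2, hp rfl, hq rfl⟩
    let Y : IndCard μ (Comp κ μ C) :=
      { J := Subtype Q
        diag := ObjectProperty.lift _ (X.subsetsFunctor F Q) fun A =>
          isCardinalPresentable_of_hasCardinalLT_arrow h.le (X.restrictSubset F Q A)
            (hasCardinalLT_arrow_of_preorder (A := A.1) A.2.2) }
    have := hasCardinalFilteredColimits_of_le κ μ h.le C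
    have := X.isIso_restrictHom F
    exact ⟨Y, ⟨(Y.isColimitExtendCocone _).coconePointUniqueUpToIso
      (X.isColimitSubsetsCocone F Q hcov) ≪≫ (asIso (X.restrictHom F) :)⟩⟩

lemma canonical_isEquivalence (h : κ < μ) (hs : SharplySmaller κ μ) (C : Type w)
    [SmallCategory C] : (canonical κ μ h.le C).IsEquivalence := by
  have := hasCardinalFilteredColimits_of_le κ μ h.le C
  exact
    { faithful := extend_faithful (κ := μ) (isCardinalPresentable (IndCard κ C) μ).ι
      full := extend_full (κ := μ) (isCardinalPresentable (IndCard κ C) μ).ι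
      essSurj := canonical_essSurj h hs C }

end EssSurj

/-! ### `κ`-directed subsets of a poset as `Ind_κ`-objects -/

section BoundedSubsets

variable (κ : Cardinal.{w}) [Fact κ.IsRegular] (J : Type w) [PartialOrder J]

/-- The subsets of cardinality `< κ` with a greatest element of a poset, ordered by inclusion.
The `Ind_κ`-objects of this poset correspond to the `κ`-directed subsets of `J`. -/
abbrev BoundedSubset : Type w := {B : Set J // HasCardinalLT B κ ∧ ∃ b, IsGreatest B b}

variable {J}

/-- A singleton as a subset with a greatest element. -/
def BoundedSubset.singleton (x : J) : BoundedSubset κ J :=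
  ⟨{x}, hasCardinalLT_of_finite _ _ (Cardinal.IsRegular.aleph0_le Fact.out), x,
    isGreatest_singleton⟩

variable {κ}

/-- The union of the members of an `Ind_κ`-object of `BoundedSubset κ J`. -/
def supp (X : IndCard κ (BoundedSubset κ J)) : Set J := ⋃ j, (X.diag.obj j).1

lemma obj_subset_supp (X : IndCard κ (BoundedSubset κ J)) (j : X.J) :
    (X.diag.obj j).1 ⊆ X.supp :=
  Set.subset_iUnion (fun j => (X.diag.obj j).1) j

/-- Any family of fewer than `κ` elements of the support lies in a single member of the diagram. In
particular the support is `κ`-directed, the members having greatest elements. -/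
lemma exists_forall_mem_obj (X : IndCard κ (BoundedSubset κ J)) {K : Type w}
    (hK : HasCardinalLT K κ) (f : K → J) (hf : ∀ k, f k ∈ X.supp) :
    ∃ j, ∀ k, f k ∈ (X.diag.obj j).1 := by
  choose j hj using fun k => Set.mem_iUnion.1 (hf k)
  exact ⟨IsCardinalFiltered.max j hK, fun k =>
    leOfHom (X.diag.map (IsCardinalFiltered.toMax j hK k)) (hj k)⟩

instance (X : IndCard κ (BoundedSubset κ J)) (c : (BoundedSubset κ J)ᵒᵖ) :
    Subsingleton (X.homColim.obj c) where
  allEq x y := by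
    obtain ⟨j, h, rfl⟩ := X.exists_cls (c := c.unop) x
    obtain ⟨j', h', rfl⟩ := X.exists_cls (c := c.unop) y
    have := isFiltered_of_isCardinalFiltered X.J κ
    rw [← X.cls_comp h (IsFiltered.leftToMax j j'), ← X.cls_comp h' (IsFiltered.rightToMax j j')]
    congr 1

instance (X Y : IndCard κ (BoundedSubset κ J)) : Subsingleton (X ⟶ Y) where
  allEq _ _ := Hom.ext_fam fun j =>
    Subsingleton.elim (α := Y.homColim.obj (op (X.diag.obj j))) _ _

lemma supp_mono {X Y : IndCard κ (BoundedSubset κ J)} (f : X ⟶ Y) : X.supp ⊆ Y.supp := by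
  refine Set.iUnion_subset fun j => ?_
  obtain ⟨j', h, -⟩ := Y.exists_cls ((Hom.fam f).1 (op j))
  exact (leOfHom h : (X.diag.obj j).1 ⊆ (Y.diag.obj j').1).trans (Y.obj_subset_supp j')

lemma nonempty_hom_of_supp_subset {X Y : IndCard κ (BoundedSubset κ J)}
    (h : X.supp ⊆ Y.supp) : Nonempty (X ⟶ Y) := by
  have key : ∀ j, Nonempty (Y.homColim.obj (op (X.diag.obj j))) := fun j => by
    obtain ⟨j', hj'⟩ := Y.exists_forall_mem_obj (X.diag.obj j).2.1 Subtype.val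
      fun x => h (X.obj_subset_supp j x.2)
    exact ⟨Y.cls j' (homOfLE fun x hx => hj' ⟨x, hx⟩)⟩
  exact ⟨Hom.mk ⟨fun j => (key j.unop).some, fun {_ j'} _ =>
    Subsingleton.elim (α := Y.homColim.obj (op (X.diag.obj j'.unop))) _ _⟩⟩

lemma supp_const (B : BoundedSubset κ J) : (const κ B).supp = B.1 :=
  Set.iUnion_const (ι := Discrete PUnit.{w + 1}) B.1

/-- The union of fewer than `κ` bounded subsets of a `κ`-directed set `A`, enlarged by an upper bound
in `A` of their greatest elements, is again a bounded subset of `A`. -/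
lemma isCardinalFiltered_boundedSubset_le (A : Set J) [IsCardinalFiltered A κ] :
    IsCardinalFiltered {B : BoundedSubset κ J // B.1 ⊆ A} κ :=
  isCardinalFiltered_preorder _ _ fun K f hK => by
    rw [← hasCardinalLT_iff_cardinal_mk_lt] at hK
    choose b hb using fun k => (f k).1.2.2
    let s : K → A := fun k => ⟨b k, (f k).2 (hb k).1⟩
    let a : A := IsCardinalFiltered.max s hK
    have ha : ∀ k, b k ≤ a := fun k => leOfHom (IsCardinalFiltered.toMax s hK k)
    have hκ : Cardinal.aleph0 ≤ κ := Cardinal.IsRegular.aleph0_le Fact.out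
    refine ⟨⟨⟨(⋃ k, (f k).1.1) ∪ {a.1}, hasCardinalLT_union hκ
      (hasCardinalLT_iUnion _ hK fun k => (f k).1.2.1) (hasCardinalLT_of_finite _ _ hκ),
      a.1, Or.inr rfl, ?_⟩, ?_⟩, fun k => ?_⟩
    · rintro x (hx | rfl)
      · obtain ⟨k, hk⟩ := Set.mem_iUnion.1 hx
        exact ((hb k).2 hk).trans (ha k)
      · exact le_rfl
    · rintro x (hx | rfl)
      · obtain ⟨k, hk⟩ := Set.mem_iUnion.1 hx
        exact (f k).2 hk
      · exact a.2
    · exact (Set.subset_iUnion (fun k => (f k).1.1) k).trans Set.subset_union_left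

/-- The `Ind_κ`-object of `BoundedSubset κ J` given by a `κ`-directed subset. -/
def ofSet (A : Set J) [IsCardinalFiltered A κ] : IndCard κ (BoundedSubset κ J) where
  J := {B : BoundedSubset κ J // B.1 ⊆ A}
  filtered := isCardinalFiltered_boundedSubset_le A
  diag := (Subtype.mono_coe _).functor

lemma supp_ofSet (A : Set J) [IsCardinalFiltered A κ] :
    (ofSet (κ := κ) A).supp = A := by
  refine (Set.iUnion_subset fun B => B.2 : (ofSet (κ := κ) A).supp ⊆ A).antisymm fun x hx => ?_
  exact Set.mem_iUnion.2 ⟨⟨BoundedSubset.singleton κ x, Set.singleton_subset_iff.2 hx⟩, rfl⟩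

/-- Supports of `μ`-compact objects are of cardinality `< μ` if `J` has a greatest element: then any
subset containing `⊤` is `κ`-directed, and `J` is the `μ`-directed union of such subsets of
cardinality `< μ`. -/
lemma hasCardinalLT_supp [OrderTop J] {μ : Cardinal.{w}} [Fact μ.IsRegular]
    (X : IndCard κ (BoundedSubset κ J)) [IsCardinalPresentable X μ] :
    HasCardinalLT X.supp μ := by
  have hμ : Cardinal.aleph0 ≤ μ := Cardinal.IsRegular.aleph0_le Fact.out
  let Q : Set J → Prop := fun A => HasCardinalLT A μ ∧ ⊤ ∈ A
  have hQ : ∀ A : Set J, ⊤ ∈ A → IsCardinalFiltered A κ := fun A hA =>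
    isCardinalFiltered_preorder _ _ fun K f _ => ⟨⟨⊤, hA⟩, fun k => le_top (a := (f k).1)⟩
  have hQ' : ∀ A : Subtype Q, IsCardinalFiltered A.1 κ := fun A => hQ _ A.2.2
  have : IsCardinalFiltered (Subtype Q) μ := isCardinalFiltered_preorder _ _ fun K f hK =>
    ⟨⟨(⋃ k, (f k).1) ∪ {⊤}, hasCardinalLT_union hμ (hasCardinalLT_iUnion _
      ((hasCardinalLT_iff_cardinal_mk_lt _ _).2 hK) fun k => (f k).2.1)
      (hasCardinalLT_of_finite _ _ hμ), Or.inr rfl⟩, fun k =>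
      (Set.subset_iUnion (fun k => (f k).1) k).trans Set.subset_union_left⟩
  have : IsCardinalFiltered (Set.univ : Set J) κ := hQ _ trivial
  have hmap : ∀ {A B : Subtype Q}, A ≤ B →
      Nonempty (ofSet (κ := κ) A.1 ⟶ ofSet (κ := κ) B.1) := fun {A B} h =>
    nonempty_hom_of_supp_subset (by rw [supp_ofSet, supp_ofSet]; exact h)
  let G : Subtype Q ⥤ IndCard κ (BoundedSubset κ J) :=
    { obj := fun A => ofSet A.1
      map := fun i => (hmap (leOfHom i)).some
      map_id := fun _ => Subsingleton.elim _ _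
      map_comp := fun _ _ => Subsingleton.elim _ _ }
  let c : Cocone G :=
    { pt := ofSet Set.univ
      ι :=
        { app := fun A => (nonempty_hom_of_supp_subset
            ((Set.subset_univ _).trans (supp_ofSet (κ := κ) (Set.univ : Set J)).ge)).some
          naturality := fun _ _ _ => Subsingleton.elim _ _ } }
  have hdesc : ∀ s : Cocone G, Nonempty (c.pt ⟶ s.pt) := fun s =>
    nonempty_hom_of_supp_subset fun x _ => supp_mono
      (s.ι.app ⟨{x, ⊤}, hasCardinalLT_of_finite _ _ hμ, Or.inr rfl⟩)
      ((supp_ofSet (κ := κ) _).ge (Or.inl rfl))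
  let hc : IsColimit c :=
    { desc := fun s => (hdesc s).some
      fac := fun _ _ => Subsingleton.elim _ _
      uniq := fun _ _ _ => Subsingleton.elim _ _ }
  -- Compactness makes `X ⟶ J` factor through some `A`, so that `supp X ⊆ A`.
  obtain ⟨f⟩ : Nonempty (X ⟶ c.pt) :=
    nonempty_hom_of_supp_subset
      ((Set.subset_univ _).trans (supp_ofSet (κ := κ) (Set.univ : Set J)).ge)
  obtain ⟨A, g, -⟩ := IsCardinalPresentable.exists_hom_of_isColimit μ hc f
  exact A.2.1.of_injective _ (Set.inclusion_injective ((supp_mono g).trans (supp_ofSet A.1).le))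

end BoundedSubsets

/-! ### Cofinal sets of small subsets -/

section Cofinal

variable {κ μ : Cardinal.{w}} [Fact κ.IsRegular] [Fact μ.IsRegular]

lemma isCardinalFiltered_smallSubsets (S : Type w) :
    IsCardinalFiltered {T : Set S // Cardinal.mk T < κ} κ :=
  isCardinalFiltered_preorder _ _ fun K f hK =>
    ⟨⟨⋃ k, (f k).1, by
      simp only [← hasCardinalLT_iff_cardinal_mk_lt] at hK ⊢
      exact hasCardinalLT_iUnion _ hK fun k => (hasCardinalLT_iff_cardinal_mk_lt _ _).2 (f k).2⟩,
      fun k => Set.subset_iUnion (fun k => (f k).1) k⟩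

/-- If `P_κ(S)`, as a `κ`-directed subset of `P_κ(S)` with a greatest element adjoined, is a
`μ`-filtered colimit of `μ`-compact objects, the support of one of these is cofinal. -/
lemma sharplySmaller_of_forall_essSurj (h : κ < μ)
    (H : ∀ (C : Type w) [SmallCategory C], (canonical κ μ h.le C).EssSurj) :
    SharplySmaller κ μ := by
  intro S hS
  rw [← hasCardinalLT_iff_cardinal_mk_lt] at hS
  let L : Type w := {T : Set S // Cardinal.mk T < κ}
  have : IsCardinalFiltered L κ := isCardinalFiltered_smallSubsets S
  let sing : S → L := fun s => ⟨{s}, (hasCardinalLT_iff_cardinal_mk_lt _ _).1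
    (hasCardinalLT_of_finite _ _ (Cardinal.IsRegular.aleph0_le Fact.out))⟩
  let A : Set (WithTop L) := Set.range WithTop.some
  have : IsCardinalFiltered A κ := isCardinalFiltered_preorder _ _ fun K f hK => by
    choose g hg using fun k => (f k).2
    rw [← hasCardinalLT_iff_cardinal_mk_lt] at hK
    refine ⟨⟨_, IsCardinalFiltered.max g hK, rfl⟩, fun k => ?_⟩
    change (f k).1 ≤ _
    rw [← hg k]
    exact WithTop.coe_le_coe.2 (leOfHom (IsCardinalFiltered.toMax g hK k))
  have := H (BoundedSubset κ (WithTop L))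
  have := hasCardinalFilteredColimits_of_le κ μ h.le (BoundedSubset κ (WithTop L))
  let X : IndCard κ (BoundedSubset κ (WithTop L)) := ofSet A
  let Y := (canonical κ μ h.le _).objPreimage X
  let e : (canonical κ μ h.le _).obj Y ≅ X := (canonical κ μ h.le _).objObjPreimageIso X
  have hc := Y.isColimitExtendCocone (isCardinalPresentable (IndCard κ _) μ).ι
  have hsing : ∀ s : S, ∃ j, WithTop.some (sing s) ∈ (Y.diag.obj j).obj.supp := fun s => by
    let E := const κ (BoundedSubset.singleton κ (WithTop.some (sing s)))
    have : IsCardinalPresentable E μ := isCardinalPresentable_of_le (κ := κ) _ h.le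
    have hE : WithTop.some (sing s) ∈ E.supp := by rw [supp_const]; rfl
    obtain ⟨f⟩ : Nonempty (E ⟶ X) := nonempty_hom_of_supp_subset (by
      rw [supp_const, supp_ofSet]
      exact Set.singleton_subset_iff.2 ⟨_, rfl⟩)
    obtain ⟨j, g, -⟩ := IsCardinalPresentable.exists_hom_of_isColimit μ hc (f ≫ e.inv)
    exact ⟨j, supp_mono g hE⟩
  choose j hj using hsing
  -- As `|S| < μ`, a single member `Z` of the `μ`-filtered diagram contains all the singletons.
  let m := IsCardinalFiltered.max j hS
  let Z : IndCard κ (BoundedSubset κ (WithTop L)) := (Y.diag.obj m).obj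
  have hZ : HasCardinalLT Z.supp μ := hasCardinalLT_supp Z
  have hZA : Z.supp ⊆ A := (supp_mono
    ((Y.extendι (isCardinalPresentable (IndCard κ _) μ).ι m : Z ⟶ _) ≫ e.hom)).trans
      (supp_ofSet A).le
  have hmem : ∀ s, WithTop.some (sing s) ∈ Z.supp := fun s =>
    supp_mono (Y.diag.map (IsCardinalFiltered.toMax j hS s)).hom (hj s)
  refine ⟨{T : L | WithTop.some T ∈ Z.supp}, fun T => ?_, ?_⟩
  -- A bound `b` in `supp Z` of the singletons `{s}`, `s ∈ T`, is a subset of `S` containing `T`; it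
  -- is not the adjoined element since `supp Z ⊆ P_κ(S)`.
  · obtain ⟨i, hi⟩ := Z.exists_forall_mem_obj ((hasCardinalLT_iff_cardinal_mk_lt _ _).2 T.2)
      (fun s : T.1 => WithTop.some (sing s)) fun s => hmem s
    obtain ⟨b, hb, hb'⟩ := (Z.diag.obj i).2.2
    obtain ⟨T', rfl⟩ := hZA (Z.obj_subset_supp i hb)
    exact ⟨T', Z.obj_subset_supp i hb, fun s hs =>
      (WithTop.coe_le_coe.1 (hb' (hi ⟨s, hs⟩)) : sing s ≤ T') rfl⟩
  · rw [← hasCardinalLT_iff_cardinal_mk_lt]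
    exact hZ.of_injective (fun T => ⟨_, T.2⟩) fun T T' hT =>
      Subtype.ext (WithTop.coe_injective (congrArg Subtype.val hT))

end Cofinal

end IndCard

theorem mainTheorem2 (κ μ : Cardinal.{w}) [Fact κ.IsRegular] [Fact μ.IsRegular] (h : κ < μ) :
    (∀ (C : Type w) [SmallCategory C], (IndCard.canonical κ μ h.le C).IsEquivalence) ↔
      SharplySmaller κ μ := by
  refine ⟨fun H => IndCard.sharplySmaller_of_forall_essSurj h fun C _ => ?_,
    fun hs C _ => IndCard.canonical_isEquivalence h hs C⟩
  have := H C
  infer_instance
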